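/- Let $\mathbb{T}^1=\mathbb{R}/\mathbb{Z}$ carry its usual metric $d(\cdot,\cdot)$ and normalised Lebesgue measure. For $\rho\in\mathbb{R}$ and $\kappa>0$ let $$F_\kappa:\mathbb{T}^1\times[0,1]\to\mathbb{T}^1\times[0,1],\qquad F_\kappa(\theta,x)=\bigl(\theta+\rho \bmod 1,\ \tanh(\kappa x)\cdot\sin(\pi\theta)\bigr),$$ where $\theta$ is represented in $[0,1)$. Let $\mathcal{A}=\bigcap_{n\in\mathbb{N}}F_\kappa^n(\mathbb{T}^1\times[0,1])$ be its global attractor, $\varphi^+(\theta)=\sup\{x\in[0,1] : (\theta,x)\in\mathcal{A}\}$ its upper bounding graph, $\Phi^+=\{(\theta,\varphi^+(\theta)) : \theta\in\mathbb{T}^1\}$, and let $\mu_{\varphi^+}$ be the Borel measure $\mu_{\varphi^+}(A)=\mathrm{Leb}_{\mathbb{T}^1}(\pi_1(A\cap\Phi^+))$ on $\mathbb{T}^1\times[0,1]$, where $\pi_1$ is the projection to $\mathbb{T}^1$. For a finite Borel measure $\mu$ on a separable metric space, the lower and upper information dimension are the limit inferior and the limit superior, as $\varepsilon\to0^+$,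 of $$\frac{\int\log\mu(B_\varepsilon(x))\,d\mu(x)}{\log\varepsilon},$$ where $B_\varepsilon(x)$ is the open ball of radius $\varepsilon$ around $x$; if they coincide, their common value is the information dimension $D_1(\mu)$. (Here $\mathbb{T}^1\times[0,1]$ carries the maximum metric.) Then for all constants $c>0$ and $d>1$ there exists $\kappa_0=\kappa_0(c,d)$ such that, for every $\rho\in\mathbb{R}$ satisfying the Diophantine condition $d(n\rho \bmod 1,\,0)\ge c\,n^{-d}$ for all integers $n\ge1$, and for every $\kappa>0$ with $\kappa\ge\kappa_0$, the information dimension of $\mu_{\varphi^+}$ exists and $D_1(\mu_{\varphi^+})=1$. -/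

import Mathlib

open MeasureTheory Filter Topology

namespace PinchedSkew

/-- `ρ` satisfies the Diophantine condition with constants `c`, `d`: the distance on the circle
`ℝ / ℤ` between `n ρ` and `0` is at least `c n ^ (-d)` for all `n ≥ 1`. -/
def IsDiophantine (c d ρ : ℝ) : Prop :=
  ∀ n : ℕ, 1 ≤ n → c * (n : ℝ) ^ (-d) ≤ dist (((n : ℝ) * ρ : ℝ) : UnitAddCircle) 0

/-- The representative in `[0, 1)` of a point of the circle `ℝ / ℤ`. -/
noncomputable def rep (θ : UnitAddCircle) : ℝ := (AddCircle.equivIco 1 0 θ : ℝ)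

theorem rep_nonneg (θ : UnitAddCircle) : 0 ≤ rep θ := (AddCircle.equivIco 1 0 θ).2.1

theorem rep_lt_one (θ : UnitAddCircle) : rep θ < 1 := by
  have h := (AddCircle.equivIco 1 0 θ).2.2
  simpa [rep] using h

theorem coe_rep (θ : UnitAddCircle) : ((rep θ : ℝ) : UnitAddCircle) = θ :=
  (AddCircle.equivIco (1 : ℝ) 0).symm_apply_apply θ

theorem fibre_mem {κ : ℝ} (hκ : 0 < κ) (θ : UnitAddCircle) (x : unitInterval) :
    Real.tanh (κ * x) * Real.sin (Real.pi * rep θ) ∈ unitInterval := by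
  have hx : 0 ≤ κ * (x : ℝ) := mul_nonneg hκ.le x.2.1
  have h0 : 0 ≤ Real.tanh (κ * x) := by
    rw [Real.tanh_eq_sinh_div_cosh]
    exact div_nonneg (Real.sinh_nonneg_iff.2 hx) (Real.cosh_pos _).le
  have h1 : Real.tanh (κ * x) ≤ 1 := by
    rw [Real.tanh_eq_sinh_div_cosh, div_le_one (Real.cosh_pos _)]
    exact (Real.sinh_lt_cosh _).le
  have hs : 0 ≤ Real.sin (Real.pi * rep θ) :=
    Real.sin_nonneg_of_nonneg_of_le_pi (mul_nonneg Real.pi_pos.le (rep_nonneg θ))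
      (mul_le_of_le_one_right Real.pi_pos.le (rep_lt_one θ).le)
  exact ⟨mul_nonneg h0 hs, mul_le_one₀ h1 hs (Real.sin_le_one _)⟩

/-- The fibre map `x ↦ tanh (κ x) sin (π θ)` of `[0, 1]`, with `θ` represented in `[0, 1)`. -/
noncomputable def fibreMap (κ : ℝ) (hκ : 0 < κ) (θ : UnitAddCircle) (x : unitInterval) :
    unitInterval :=
  ⟨Real.tanh (κ * x) * Real.sin (Real.pi * rep θ), fibre_mem hκ θ x⟩

/-- The skew product `F_κ (θ, x) = (θ + ρ mod 1, tanh (κ x) sin (π θ))`. -/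
noncomputable def skewMap (ρ κ : ℝ) (hκ : 0 < κ) (p : UnitAddCircle × unitInterval) :
    UnitAddCircle × unitInterval :=
  (p.1 + (ρ : UnitAddCircle), fibreMap κ hκ p.1 p.2)

/-- The global attractor `⋂ n, F_κ ^ n (𝕋 × [0, 1])`. -/
def attractor (ρ κ : ℝ) (hκ : 0 < κ) : Set (UnitAddCircle × unitInterval) :=
  ⋂ n : ℕ, (skewMap ρ κ hκ)^[n] '' Set.univ

/-- The upper bounding graph `φ⁺ θ = sup {x ∈ [0, 1] | (θ, x) ∈ attractor}`. -/
noncomputable def upperGraph (ρ κ : ℝ) (hκ : 0 < κ) (θ : UnitAddCircle) : unitInterval :=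
  sSup {x : unitInterval | (θ, x) ∈ attractor ρ κ hκ}

/-- The measure `μ_φ` associated with a function `φ`: Lebesgue measure on the circle, lifted
to the graph of `φ`. -/
noncomputable def graphMeasure (φ : UnitAddCircle → unitInterval) :
    Measure (UnitAddCircle × unitInterval) :=
  Measure.map (fun θ => (θ, φ θ)) volume

/-- `μ_φ (A) = Leb (π₁ (A ∩ Φ))`, where `Φ` is the graph of `φ`. -/
theorem graphMeasure_apply {φ : UnitAddCircle → unitInterval} (hφ : Measurable φ)
    {A : Set (UnitAddCircle × unitInterval)} (hA : MeasurableSet A) :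
    graphMeasure φ A = volume (Prod.fst '' (A ∩ Set.range fun θ => (θ, φ θ))) := by
  have hm : Measurable fun θ : UnitAddCircle => (θ, φ θ) := measurable_id.prodMk hφ
  rw [graphMeasure, Measure.map_apply hm hA]
  congr 1
  ext θ
  constructor
  · intro h
    exact ⟨(θ, φ θ), ⟨h, θ, rfl⟩, rfl⟩
  · rintro ⟨_, ⟨h, θ', rfl⟩, rfl⟩
    exact h

section InformationDimension

variable {X : Type*} [MetricSpace X] [MeasurableSpace X]

/-- The quotient `(∫ log μ (B_ε (x)) dμ (x)) / log ε`. -/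
noncomputable def infoRatio (μ : Measure X) (ε : ℝ) : ℝ :=
  (∫ x, Real.log (μ.real (Metric.ball x ε)) ∂μ) / Real.log ε

/-- The lower information dimension of `μ` (the integrals are meant to exist). -/
noncomputable def lowerInfoDim (μ : Measure X) : EReal :=
  liminf (fun ε : ℝ => (infoRatio μ ε : EReal)) (𝓝[>] 0)

/-- The upper information dimension of `μ` (the integrals are meant to exist). -/
noncomputable def upperInfoDim (μ : Measure X) : EReal :=
  limsup (fun ε : ℝ => (infoRatio μ ε : EReal)) (𝓝[>] 0)

/-- The information dimension of `μ` exists and equals the real number `D`: the integrals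
defining it are finite for all small `ε > 0`, and the lower and the upper information dimension
are both equal to `D`. -/
def HasInfoDim (μ : Measure X) (D : ℝ) : Prop :=
  (∀ᶠ ε : ℝ in 𝓝[>] 0, Integrable (fun x => Real.log (μ.real (Metric.ball x ε))) μ) ∧
    lowerInfoDim μ = (D : EReal) ∧ upperInfoDim μ = (D : EReal)

end InformationDimension

end PinchedSkew

/-!
The graph `φ⁺` is Lipschitz on sets of measure arbitrarily close to one, and this forces the
information dimension of its graph measure to be one. The Diophantine condition enters through the
irrationality of `ρ`, which makes the rotation ergodic.

*Values of `φ⁺` are rarely small.* Let `ψ n` be the iterated upper boundary lines, which decrease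
to `φ⁺`. They satisfy
`log ψ (n + 1) (θ + ρ) = log ψ n θ + log (tanh (κ ψ n θ) / ψ n θ) + log sin (π θ)`.
The integrals of `log ψ n` decrease with `n`, so integration shows that
`∫ log (tanh (κ ψ n) / ψ n)` is at most `S = -∫ log sin (π θ)`. The integrand is at least
`log tanh κ`, and it is large where `ψ n` is small: it is at least `log (tanh (κ x) / x)` on
`{ψ n < x}`. Hence `{φ⁺ < x}` has measure at most `(S + log 2) / (-log x)` once `1 ≤ κ x`
(`measureReal_upperGraph_lt_mul_le`). For `x = κ ^ (-1 / 2)` and large `κ` this is less than `1 / 8`.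

*Lipschitz pieces.* By the maximal ergodic inequality and ergodicity of the rotation, off a set of
small measure the backward orbit of `θ` visits `{φ⁺ < x}` at most `n / 8 + C` times up to time `n`,
with a uniform `C` (`exists_measure_visits_gt_le`). A step of the fibre dynamics at which both of two
points are above `x` contracts by `κ / cosh² (κ x) ≤ κ⁻¹`, and any step expands by at most `κ`. Along
two such backward orbits contraction therefore wins exponentially, and the invariance of `φ⁺` turns
this into a Lipschitz estimate (`exists_lipschitz_upperGraph`).

*Dimension.* A ball of radius `ε` around a point of the graph has measure at most `2 ε`, which gives
the lower bound. For the upper bound, `-∫ log μ (B_ε)` is at most the entropy of a grid partition of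
mesh `1 / N ≤ ε`. The Lipschitz piece meets `O(N)` cells, the rest has mass at most `δ` and meets
`O(N²)` cells, so Gibbs' inequality bounds the entropy by `(1 + 2 δ) log N + O(1)`
(`entropy_gridCell_le`, `hasInfoDim_graphMeasure`).
-/

namespace PinchedSkew

/-! ### The hyperbolic tangent -/

theorem hasDerivAt_tanh (x : ℝ) : HasDerivAt Real.tanh (1 / Real.cosh x ^ 2) x := by
  have h := (Real.hasDerivAt_sinh x).div (Real.hasDerivAt_cosh x) (Real.cosh_pos x).ne'
  have e : (Real.sinh / Real.cosh) = Real.tanh := by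
    funext y
    simp [Real.tanh_eq_sinh_div_cosh]
  rw [e] at h
  rw [← sq, ← sq, Real.cosh_sq_sub_sinh_sq] at h
  exact h

theorem continuous_tanh : Continuous Real.tanh :=
  continuous_iff_continuousAt.2 fun x => (hasDerivAt_tanh x).continuousAt

theorem strictMono_tanh : StrictMono Real.tanh :=
  strictMono_of_deriv_pos fun x => by
    rw [(hasDerivAt_tanh x).deriv]
    have := Real.cosh_pos x
    positivity

theorem tanh_nonneg {x : ℝ} (hx : 0 ≤ x) : 0 ≤ Real.tanh x := by
  simpa using strictMono_tanh.monotone hx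

theorem tanh_pos {x : ℝ} (hx : 0 < x) : 0 < Real.tanh x := by
  simpa using strictMono_tanh hx

theorem cosh_le_cosh_of_le {x y : ℝ} (hx : 0 ≤ x) (hxy : x ≤ y) : Real.cosh x ≤ Real.cosh y :=
  Real.cosh_le_cosh.2 (by rwa [abs_of_nonneg hx, abs_of_nonneg (hx.trans hxy)])

/-- On `[m, ∞)` with `0 ≤ m` the derivative of `tanh` is at most `1 / cosh² m`. -/
theorem abs_tanh_sub_tanh_le {m x y : ℝ} (hm : 0 ≤ m) (hx : m ≤ x) (hy : m ≤ y) :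
    |Real.tanh x - Real.tanh y| ≤ 1 / Real.cosh m ^ 2 * |x - y| := by
  refine (convex_Ici m).norm_image_sub_le_of_norm_hasDerivWithin_le
    (f := Real.tanh) (f' := fun z => 1 / Real.cosh z ^ 2)
    (fun z _ => (hasDerivAt_tanh z).hasDerivWithinAt) (fun z hz => ?_) hy hx
  have hz' : m ≤ z := hz
  have h1 := Real.cosh_pos m
  have h2 := cosh_le_cosh_of_le hm hz'
  rw [Real.norm_of_nonneg (by positivity)]
  gcongr

/-- `tanh` is concave on `[0, ∞)` and vanishes at `0`, so it lies above its chords from `0`. -/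
theorem mul_tanh_le_tanh_mul {t x : ℝ} (ht0 : 0 ≤ t) (ht1 : t ≤ 1) (hx : 0 ≤ x) :
    t * Real.tanh x ≤ Real.tanh (t * x) := by
  have hconc : ConcaveOn ℝ (Set.Ici 0) Real.tanh := by
    refine AntitoneOn.concaveOn_of_deriv (convex_Ici 0) continuous_tanh.continuousOn
      (fun z _ => (hasDerivAt_tanh z).differentiableAt.differentiableWithinAt) ?_
    intro y hy z hz hyz
    rw [interior_Ici] at hy hz
    rw [(hasDerivAt_tanh y).deriv, (hasDerivAt_tanh z).deriv]
    have h1 := Real.cosh_pos y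
    have h2 := cosh_le_cosh_of_le (le_of_lt hy) hyz
    gcongr
  have h := hconc.2 (Set.mem_Ici.2 hx) (Set.mem_Ici.2 le_rfl) ht0 (sub_nonneg.2 ht1)
    (by ring)
  simpa using h

theorem half_le_tanh {x : ℝ} (hx : 1 ≤ x) : 1 / 2 ≤ Real.tanh x := by
  refine le_trans ?_ (strictMono_tanh.monotone hx)
  rw [Real.tanh_eq, div_le_div_iff₀ two_pos (by positivity)]
  have h1 : (2 : ℝ) ≤ Real.exp 1 := by linarith [Real.add_one_le_exp (1 : ℝ)]
  have h2 : Real.exp (-1) ≤ 1 / 2 := by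
    rw [Real.exp_neg, ← one_div]
    exact one_div_le_one_div_of_le two_pos h1
  linarith

/-! ### The forcing term on the circle -/

/-- The forcing term `θ ↦ sin (π θ)` on the circle. -/
noncomputable def forcing (θ : UnitAddCircle) : ℝ := Real.sin (Real.pi * rep θ)

theorem forcing_nonneg (θ : UnitAddCircle) : 0 ≤ forcing θ :=
  Real.sin_nonneg_of_nonneg_of_le_pi (mul_nonneg Real.pi_pos.le (rep_nonneg θ))
    (mul_le_of_le_one_right Real.pi_pos.le (rep_lt_one θ).le)

theorem forcing_le_one (θ : UnitAddCircle) : forcing θ ≤ 1 := Real.sin_le_one _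

theorem forcing_pos {θ : UnitAddCircle} (hθ : θ ≠ 0) : 0 < forcing θ := by
  have h0 : rep θ ≠ 0 := by
    intro h
    apply hθ
    rw [← coe_rep θ, h]
    simp
  exact Real.sin_pos_of_pos_of_lt_pi
    (mul_pos Real.pi_pos (lt_of_le_of_ne (rep_nonneg θ) h0.symm))
    (mul_lt_of_lt_one_right Real.pi_pos (rep_lt_one θ))

/-- The function `|sin (π t)|` has period one, so any real representative computes the forcing. -/
theorem forcing_coe (t : ℝ) : forcing (t : UnitAddCircle) = |Real.sin (Real.pi * t)| := by
  have h : ((rep (t : UnitAddCircle) - t : ℝ) : UnitAddCircle) = 0 := by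
    rw [AddCircle.coe_sub, coe_rep, sub_self]
  obtain ⟨n, hn⟩ := (AddCircle.coe_eq_zero_iff (1 : ℝ)).1 h
  rw [← abs_of_nonneg (forcing_nonneg _), forcing]
  have e : Real.pi * rep (t : UnitAddCircle) = Real.pi * t + n * Real.pi := by
    rw [zsmul_one] at hn
    rw [hn]
    ring
  rw [e, Real.sin_add_int_mul_pi, abs_mul, abs_zpow, abs_neg, abs_one, one_zpow, one_mul]

theorem abs_forcing_sub_forcing_le (θ θ' : UnitAddCircle) :
    |forcing θ - forcing θ'| ≤ Real.pi * dist θ θ' := by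
  set n := round (rep θ - rep θ') with hn
  have hd : dist θ θ' = |rep θ - (rep θ' + n)| := by
    rw [dist_eq_norm]
    conv_lhs => rw [← coe_rep θ, ← coe_rep θ', ← AddCircle.coe_sub]
    rw [UnitAddCircle.norm_eq, ← hn]
    congr 1
    ring
  have h1 : forcing θ = |Real.sin (Real.pi * rep θ)| := by rw [← forcing_coe, coe_rep]
  have h2 : forcing θ' = |Real.sin (Real.pi * (rep θ' + n))| := by
    have h3 : ((n : ℝ) : UnitAddCircle) = 0 :=
      (AddCircle.coe_eq_zero_iff (1 : ℝ)).2 ⟨n, zsmul_one n⟩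
    rw [← forcing_coe, AddCircle.coe_add, coe_rep, h3, add_zero]
  rw [h1, h2, hd]
  refine (abs_abs_sub_abs_le _ _).trans ?_
  refine (Real.abs_sin_sub_sin_le _ _).trans (le_of_eq ?_)
  rw [← mul_sub, abs_mul, abs_of_pos Real.pi_pos]

theorem continuous_forcing : Continuous forcing := by
  refine LipschitzWith.continuous (K := ⟨Real.pi, Real.pi_pos.le⟩) ?_
  exact LipschitzWith.of_dist_le_mul fun x y => by
    rw [Real.dist_eq]
    exact abs_forcing_sub_forcing_le x y

theorem integrable_log_forcing : Integrable fun θ => Real.log (forcing θ) := by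
  have hm : AEStronglyMeasurable (fun θ => Real.log (forcing θ)) :=
    (Real.measurable_log.comp continuous_forcing.measurable).aestronglyMeasurable
  rw [← (UnitAddCircle.measurePreserving_mk 0).integrable_comp hm]
  have h : IntervalIntegrable (fun x => Real.log (Real.sin (Real.pi * x))) volume 0 1 := by
    have := (intervalIntegrable_log_sin (a := 0) (b := Real.pi)).comp_mul_left (c := Real.pi)
    simpa [Real.pi_pos.ne'] using this
  rw [intervalIntegrable_iff_integrableOn_Ioc_of_le zero_le_one] at h
  simp only [zero_add]
  refine h.congr (ae_of_all _ fun t => ?_)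
  simp [forcing_coe, Real.log_abs]

instance : IsProbabilityMeasure (volume : Measure UnitAddCircle) := ⟨UnitAddCircle.measure_univ⟩

theorem ae_forcing_pos : ∀ᵐ θ : UnitAddCircle, 0 < forcing θ := by
  have h : volume ({0} : Set UnitAddCircle) = 0 := by
    have := AddCircle.volume_closedBall (1 : ℝ) (x := 0) 0
    simpa using this
  filter_upwards [measure_eq_zero_iff_ae_notMem.1 h] with θ hθ
  exact forcing_pos hθ

/-! ### Iterated upper boundary lines and the upper bounding graph -/

/-- The `n`-th iterated upper boundary line: the fibre of `F_κ ^ n (𝕋 × [0, 1])` over `θ` is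
`[0, upperLine ρ κ n θ]`. -/
noncomputable def upperLine (ρ κ : ℝ) : ℕ → UnitAddCircle → ℝ
  | 0, _ => 1
  | n + 1, θ => Real.tanh (κ * upperLine ρ κ n (θ - ρ)) * forcing (θ - ρ)

section

variable {ρ κ : ℝ}

theorem upperLine_add (n : ℕ) (θ : UnitAddCircle) :
    upperLine ρ κ (n + 1) (θ + ρ) = Real.tanh (κ * upperLine ρ κ n θ) * forcing θ := by
  rw [upperLine, add_sub_cancel_right]

theorem upperLine_nonneg (hκ : 0 < κ) (n : ℕ) (θ : UnitAddCircle) : 0 ≤ upperLine ρ κ n θ := by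
  induction n generalizing θ with
  | zero => exact zero_le_one
  | succ n ih =>
    exact mul_nonneg (tanh_nonneg (mul_nonneg hκ.le (ih _))) (forcing_nonneg _)

theorem upperLine_le_one (n : ℕ) (θ : UnitAddCircle) : upperLine ρ κ n θ ≤ 1 := by
  cases n with
  | zero => exact le_rfl
  | succ n => exact mul_le_one₀ (Real.tanh_lt_one _).le (forcing_nonneg _) (forcing_le_one _)

theorem upperLine_succ_le (hκ : 0 < κ) (n : ℕ) (θ : UnitAddCircle) :
    upperLine ρ κ (n + 1) θ ≤ upperLine ρ κ n θ := by
  induction n generalizing θ with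
  | zero => exact upperLine_le_one 1 θ
  | succ n ih =>
    exact mul_le_mul_of_nonneg_right
      (strictMono_tanh.monotone (mul_le_mul_of_nonneg_left (ih _) hκ.le)) (forcing_nonneg _)

theorem antitone_upperLine (hκ : 0 < κ) (θ : UnitAddCircle) :
    Antitone fun n => upperLine ρ κ n θ :=
  antitone_nat_of_succ_le fun n => upperLine_succ_le hκ n θ

theorem continuous_upperLine (n : ℕ) : Continuous (upperLine ρ κ n) := by
  induction n with
  | zero => exact continuous_const
  | succ n ih =>
    have h : Continuous fun θ : UnitAddCircle => θ - ρ := continuous_id.sub continuous_const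
    exact (continuous_tanh.comp (continuous_const.mul (ih.comp h))).mul
      (continuous_forcing.comp h)

theorem mem_image_iterate_iff (hκ : 0 < κ) (n : ℕ) (θ : UnitAddCircle) (x : unitInterval) :
    (θ, x) ∈ (skewMap ρ κ hκ)^[n] '' Set.univ ↔ (x : ℝ) ≤ upperLine ρ κ n θ := by
  induction n generalizing θ x with
  | zero => simpa [upperLine] using x.2.2
  | succ n ih =>
    rw [Function.iterate_succ', Set.image_comp]
    constructor
    · rintro ⟨⟨θ', x'⟩, hmem, heq⟩
      obtain ⟨rfl, rfl⟩ := Prod.mk.inj heq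
      rw [upperLine_add]
      exact mul_le_mul_of_nonneg_right (strictMono_tanh.monotone
        (mul_le_mul_of_nonneg_left ((ih _ _).1 hmem) hκ.le)) (forcing_nonneg _)
    · intro hx
      set θ' : UnitAddCircle := θ - ρ with hθ'
      have hcont : Continuous fun y : ℝ => Real.tanh (κ * y) * forcing θ' :=
        (continuous_tanh.comp (continuous_const.mul continuous_id)).mul continuous_const
      obtain ⟨y, hy, hyx⟩ := intermediate_value_Icc (upperLine_nonneg (ρ := ρ) hκ n θ')
        hcont.continuousOn (show (x : ℝ) ∈ Set.Icc _ _ from ⟨by simpa using x.2.1, hx⟩)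
      refine ⟨(θ', ⟨y, hy.1, hy.2.trans (upperLine_le_one _ _)⟩), (ih _ _).2 hy.2, ?_⟩
      exact Prod.ext (sub_add_cancel _ _) (Subtype.ext hyx)

theorem bddBelow_upperLine (hκ : 0 < κ) (θ : UnitAddCircle) :
    BddBelow (Set.range fun n => upperLine ρ κ n θ) :=
  ⟨0, by rintro _ ⟨n, rfl⟩; exact upperLine_nonneg hκ n θ⟩

theorem upperGraph_eq_iInf (hκ : 0 < κ) (θ : UnitAddCircle) :
    (upperGraph ρ κ hκ θ : ℝ) = ⨅ n, upperLine ρ κ n θ := by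
  have hmem : (⨅ n, upperLine ρ κ n θ) ∈ unitInterval :=
    ⟨le_ciInf fun n => upperLine_nonneg hκ n θ,
      (ciInf_le (bddBelow_upperLine hκ θ) 0).trans (upperLine_le_one 0 θ)⟩
  have hset : {x : unitInterval | (θ, x) ∈ attractor ρ κ hκ}
      = Set.Iic (⟨_, hmem⟩ : unitInterval) := by
    ext x
    simp only [attractor, Set.mem_ofPred_eq, Set.mem_iInter, mem_image_iterate_iff, Set.mem_Iic]
    rw [← Subtype.coe_le_coe]
    exact (le_ciInf_iff (bddBelow_upperLine hκ θ)).symm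
  rw [upperGraph, hset, isLUB_Iic.sSup_eq]

theorem tendsto_upperLine (hκ : 0 < κ) (θ : UnitAddCircle) :
    Tendsto (fun n => upperLine ρ κ n θ) atTop (𝓝 (upperGraph ρ κ hκ θ : ℝ)) := by
  rw [upperGraph_eq_iInf]
  exact tendsto_atTop_ciInf (antitone_upperLine hκ θ) (bddBelow_upperLine hκ θ)

theorem upperGraph_lt_iff (hκ : 0 < κ) (θ : UnitAddCircle) (x : ℝ) :
    (upperGraph ρ κ hκ θ : ℝ) < x ↔ ∃ n, upperLine ρ κ n θ < x := by
  rw [upperGraph_eq_iInf, ciInf_lt_iff (bddBelow_upperLine hκ θ)]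

theorem measurable_upperGraph (hκ : 0 < κ) : Measurable (upperGraph ρ κ hκ) := by
  refine (MeasurableEmbedding.subtype_coe measurableSet_Icc).measurable_comp_iff.1 ?_
  have : (Subtype.val ∘ upperGraph ρ κ hκ) = fun θ => ⨅ n, upperLine ρ κ n θ :=
    funext fun θ => upperGraph_eq_iInf hκ θ
  rw [this]
  exact Measurable.iInf fun n => (continuous_upperLine n).measurable

/-- The upper bounding graph is invariant under the skew product. -/
theorem upperGraph_add (hκ : 0 < κ) (θ : UnitAddCircle) :
    (upperGraph ρ κ hκ (θ + ρ) : ℝ) = Real.tanh (κ * upperGraph ρ κ hκ θ) * forcing θ := by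
  refine tendsto_nhds_unique ((tendsto_upperLine hκ (θ + ρ)).comp (tendsto_add_atTop_nat 1)) ?_
  have h := ((continuous_tanh.tendsto _).comp
    ((tendsto_upperLine (ρ := ρ) hκ θ).const_mul κ)).mul_const (forcing θ)
  refine h.congr fun n => ?_
  simp only [Function.comp_apply]
  rw [upperLine_add]

end

/-! ### The upper bounding graph is rarely small -/

section

variable {ρ κ : ℝ}

theorem ae_upperLine_pos (hκ : 0 < κ) (n : ℕ) :
    ∀ᵐ θ : UnitAddCircle, 0 < upperLine ρ κ n θ := by
  induction n with
  | zero => exact ae_of_all _ fun _ => zero_lt_one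
  | succ n ih =>
    have hT := (measurePreserving_sub_right (volume : Measure UnitAddCircle)
      (ρ : UnitAddCircle)).quasiMeasurePreserving
    filter_upwards [hT.ae ih, hT.ae ae_forcing_pos] with θ h1 h2
    exact mul_pos (tanh_pos (mul_pos hκ h1)) h2

theorem neg_log_two_le_log_tanh {x : ℝ} (hx : 1 ≤ x) : -Real.log 2 ≤ Real.log (Real.tanh x) := by
  rw [← Real.log_inv, ← one_div]
  exact Real.log_le_log (by norm_num) (half_le_tanh hx)

/-- The factor by which `y ↦ tanh (κ y)` expands the distance to `0` decreases in `y`. -/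
theorem log_tanh_sub_log_le {x y : ℝ} (hκ : 0 < κ) (hy : 0 < y) (hyx : y ≤ x) :
    Real.log (Real.tanh (κ * x)) - Real.log x ≤ Real.log (Real.tanh (κ * y)) - Real.log y := by
  have hx : 0 < x := hy.trans_le hyx
  have h := mul_tanh_le_tanh_mul (div_nonneg hy.le hx.le) ((div_le_one hx).2 hyx)
    (mul_nonneg hκ.le hx.le)
  have e : y / x * (κ * x) = κ * y := by
    field_simp
  rw [e] at h
  have hpos := tanh_pos (mul_pos hκ hx)
  have h2 := Real.log_le_log (mul_pos (div_pos hy hx) hpos) h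
  rw [Real.log_mul (div_pos hy hx).ne' hpos.ne', Real.log_div hy.ne' hx.ne'] at h2
  linarith

theorem log_upperLine_add (hκ : 0 < κ) {n : ℕ} {θ : UnitAddCircle} (h1 : 0 < upperLine ρ κ n θ)
    (h2 : 0 < forcing θ) : Real.log (upperLine ρ κ (n + 1) (θ + ρ)) =
      Real.log (Real.tanh (κ * upperLine ρ κ n θ)) + Real.log (forcing θ) := by
  rw [upperLine_add, Real.log_mul (tanh_pos (mul_pos hκ h1)).ne' h2.ne']

theorem integrable_log_upperLine (hκ : 0 < κ) (n : ℕ) :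
    Integrable fun θ => Real.log (upperLine ρ κ n θ) := by
  induction n with
  | zero => simp [upperLine]
  | succ n ih =>
    have hT := measurePreserving_add_right (volume : Measure UnitAddCircle) (ρ : UnitAddCircle)
    have hm : AEStronglyMeasurable fun θ => Real.log (upperLine ρ κ (n + 1) θ) :=
      (Real.measurable_log.comp (continuous_upperLine _).measurable).aestronglyMeasurable
    refine (hT.integrable_comp hm).1 ?_
    refine Integrable.mono (ih.add (integrable_log_forcing.add
      (integrable_const (Real.log (Real.tanh κ))))) (hm.comp_measurePreserving hT) ?_
    filter_upwards [ae_upperLine_pos (ρ := ρ) hκ n, ae_forcing_pos] with θ h1 h2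
    have h3 := log_tanh_sub_log_le hκ h1 (upperLine_le_one n θ)
    rw [mul_one, Real.log_one, sub_zero] at h3
    have h4 : Real.log (upperLine ρ κ (n + 1) (θ + ρ)) ≤ 0 :=
      Real.log_nonpos (upperLine_nonneg hκ _ _) (upperLine_le_one _ _)
    have h5 := log_upperLine_add hκ h1 h2
    simp only [Function.comp_apply, Pi.add_apply, Real.norm_eq_abs]
    rw [abs_of_nonpos h4, abs_of_nonpos (by linarith)]
    linarith

/-- If `u (θ + a) = g θ + v θ + w θ` with `u ≤ v`, then the integral of `g` is at most that
of `-w`. -/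
theorem integral_le_of_comp_add_eq {u v w g : UnitAddCircle → ℝ} {a : UnitAddCircle}
    (hu : Integrable u) (hv : Integrable v) (hw : Integrable w) (huv : u ≤ᵐ[volume] v)
    (h : ∀ᵐ θ : UnitAddCircle, u (θ + a) = g θ + v θ + w θ) :
    Integrable g ∧ ∫ θ, g θ ≤ -∫ θ, w θ := by
  have hu' : Integrable fun θ => u (θ + a) :=
    (measurePreserving_add_right volume a).integrable_comp_of_integrable hu
  have hae : (fun θ => u (θ + a) - w θ - v θ) =ᵐ[volume] g := by
    filter_upwards [h] with θ h1
    rw [h1]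
    ring
  have h2 : ∫ θ, u (θ + a) = ∫ θ, u θ := integral_add_right_eq_self u a
  have h3 := integral_mono_ae hu hv huv
  refine ⟨((hu'.sub hw).sub hv).congr hae, ?_⟩
  have h4 : ∫ θ, g θ = (∫ θ, u (θ + a)) - (∫ θ, w θ) - ∫ θ, v θ := by
    rw [← integral_congr_ae hae, ← integral_sub hu' hw]
    exact integral_sub (hu'.sub hw) hv
  linarith

/-- The mean logarithmic expansion along the iterated upper boundary lines is at most
`-∫ log (sin (π θ))`, because the integrals of `log (upperLine ρ κ n)` decrease with `n`. -/
theorem integral_log_expansion_le (hκ : 0 < κ) (n : ℕ) :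
    (Integrable fun θ => Real.log (Real.tanh (κ * upperLine ρ κ n θ)) -
        Real.log (upperLine ρ κ n θ)) ∧
      ∫ θ, (Real.log (Real.tanh (κ * upperLine ρ κ n θ)) - Real.log (upperLine ρ κ n θ)) ≤
        -∫ θ, Real.log (forcing θ) := by
  refine integral_le_of_comp_add_eq (a := (ρ : UnitAddCircle))
    (integrable_log_upperLine (ρ := ρ) hκ (n + 1)) (integrable_log_upperLine (ρ := ρ) hκ n)
    integrable_log_forcing ?_ ?_
  · filter_upwards [ae_upperLine_pos (ρ := ρ) hκ (n + 1)] with θ h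
    exact Real.log_le_log h (upperLine_succ_le hκ n θ)
  · filter_upwards [ae_upperLine_pos (ρ := ρ) hκ n, ae_forcing_pos] with θ h1 h2
    rw [log_upperLine_add hκ h1 h2]
    ring

theorem measureReal_upperLine_lt_mul_le (hκ : 1 ≤ κ) {x : ℝ} (hx : 1 ≤ κ * x) (n : ℕ) :
    volume.real {θ | upperLine ρ κ n θ < x} * -Real.log x ≤
      Real.log 2 - ∫ θ, Real.log (forcing θ) := by
  have hκ0 : 0 < κ := one_pos.trans_le hκ
  obtain ⟨hi, hle⟩ := integral_log_expansion_le (ρ := ρ) hκ0 n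
  set B : Set UnitAddCircle := {θ | upperLine ρ κ n θ < x} with hB
  have hBm : MeasurableSet B :=
    measurableSet_lt (continuous_upperLine n).measurable measurable_const
  have hb : Integrable (B.indicator fun _ => -Real.log x) :=
    (integrable_const _).indicator hBm
  have hlow : ∫ θ, (B.indicator (fun _ => -Real.log x) θ - Real.log 2) ≤
      ∫ θ, (Real.log (Real.tanh (κ * upperLine ρ κ n θ)) - Real.log (upperLine ρ κ n θ)) := by
    refine integral_mono_ae (hb.sub (integrable_const _)) hi ?_
    filter_upwards [ae_upperLine_pos (ρ := ρ) hκ0 n] with θ hpos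
    by_cases hθ : θ ∈ B
    · have h1 := log_tanh_sub_log_le hκ0 hpos (le_of_lt (show upperLine ρ κ n θ < x from hθ))
      have h2 := neg_log_two_le_log_tanh hx
      rw [Set.indicator_of_mem hθ]
      linarith
    · have h1 := log_tanh_sub_log_le hκ0 hpos (upperLine_le_one n θ)
      have h2 := neg_log_two_le_log_tanh hκ
      rw [mul_one, Real.log_one] at h1
      rw [Set.indicator_of_notMem hθ]
      linarith
  rw [integral_sub hb (integrable_const _), integral_indicator_const _ hBm] at hlow
  simp only [smul_eq_mul, integral_const, probReal_univ, one_mul] at hlow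
  linarith

/-- The upper bounding graph is rarely small. -/
theorem measureReal_upperGraph_lt_mul_le (hκ0 : 0 < κ) (hκ : 1 ≤ κ) {x : ℝ} (hx : 1 ≤ κ * x) :
    volume.real {θ | (upperGraph ρ κ hκ0 θ : ℝ) < x} * -Real.log x ≤
      Real.log 2 - ∫ θ, Real.log (forcing θ) := by
  have hU : {θ | (upperGraph ρ κ hκ0 θ : ℝ) < x} = ⋃ n, {θ | upperLine ρ κ n θ < x} := by
    ext θ
    simp [upperGraph_lt_iff]
  have hmono : Monotone fun n => {θ | upperLine ρ κ n θ < x} :=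
    monotone_nat_of_le_succ fun n θ h => (upperLine_succ_le hκ0 n θ).trans_lt h
  have hlim : Tendsto (fun n => volume.real {θ | upperLine ρ κ n θ < x}) atTop
      (𝓝 (volume.real {θ | (upperGraph ρ κ hκ0 θ : ℝ) < x})) := by
    rw [hU]
    exact (ENNReal.tendsto_toReal (measure_ne_top _ _)).comp
      (tendsto_measure_iUnion_atTop (μ := volume) hmono)
  exact le_of_tendsto (hlim.mul_const _)
    (Eventually.of_forall fun n => measureReal_upperLine_lt_mul_le hκ hx n)

end

/-! ### Maximal ergodic inequality and visit frequencies -/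

section Ergodic

variable {α : Type*}

/-- The maximum of the Birkhoff sums of `f` of length at most `n`, the empty sum included. -/
noncomputable def maxBirkhoff (T : α → α) (f : α → ℝ) : ℕ → α → ℝ
  | 0, _ => 0
  | n + 1, x => max 0 (f x + maxBirkhoff T f n (T x))

theorem maxBirkhoff_nonneg (T : α → α) (f : α → ℝ) (n : ℕ) (x : α) :
    0 ≤ maxBirkhoff T f n x := by
  cases n with
  | zero => exact le_rfl
  | succ n => exact le_max_left _ _

theorem maxBirkhoff_le_succ (T : α → α) (f : α → ℝ) (n : ℕ) (x : α) :
    maxBirkhoff T f n x ≤ maxBirkhoff T f (n + 1) x := by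
  induction n generalizing x with
  | zero => exact maxBirkhoff_nonneg T f 1 x
  | succ n ih => exact max_le_max le_rfl (add_le_add le_rfl (ih _))

theorem birkhoffSum_le_maxBirkhoff (T : α → α) (f : α → ℝ) (n : ℕ) (x : α) :
    birkhoffSum T f n x ≤ maxBirkhoff T f n x := by
  induction n generalizing x with
  | zero => simp [maxBirkhoff]
  | succ n ih =>
    rw [birkhoffSum_succ']
    exact (add_le_add le_rfl (ih _)).trans (le_max_right _ _)

/-- The number of visits to `B` of the orbit segment `x, T x, …, T ^ (n - 1) x`. -/
noncomputable def visits (T : α → α) (B : Set α) (n : ℕ) (x : α) : ℝ :=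
  birkhoffSum T (B.indicator 1) n x

theorem visits_succ (T : α → α) (B : Set α) (n : ℕ) (x : α) :
    visits T B (n + 1) x = B.indicator 1 x + visits T B n (T x) :=
  birkhoffSum_succ' _ _ _ _

theorem visits_one (T : α → α) (B : Set α) (x : α) : visits T B 1 x = B.indicator 1 x :=
  birkhoffSum_one T _ x

variable [MeasurableSpace α] {μ : Measure α}

theorem integrable_maxBirkhoff {T : α → α} (hT : MeasurePreserving T μ μ) {f : α → ℝ}
    (hf : Integrable f μ) (n : ℕ) : Integrable (maxBirkhoff T f n) μ := by
  induction n with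
  | zero => exact integrable_zero _ _ _
  | succ n ih => exact (integrable_zero _ _ _).sup (hf.add (hT.integrable_comp_of_integrable ih))

/-- The maximal ergodic inequality: `f` has nonnegative integral over the set where some Birkhoff
sum of length at most `n` is positive. -/
theorem setIntegral_maxBirkhoff_pos_nonneg {T : α → α} (hT : MeasurePreserving T μ μ) {f : α → ℝ}
    (hf : Integrable f μ) (n : ℕ) (hA : MeasurableSet {x | 0 < maxBirkhoff T f n x}) :
    0 ≤ ∫ x in {x | 0 < maxBirkhoff T f n x}, f x ∂μ := by
  set M := maxBirkhoff T f n with hM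
  set A := {x | 0 < M x} with hAdef
  have hMi : Integrable M μ := integrable_maxBirkhoff hT hf n
  have hMT : Integrable (fun x => M (T x)) μ := hT.integrable_comp_of_integrable hMi
  have h1 : ∫ x in A, M x ∂μ = ∫ x, M x ∂μ := by
    refine setIntegral_eq_integral_of_forall_compl_eq_zero fun x hx => ?_
    exact le_antisymm (not_lt.1 hx) (maxBirkhoff_nonneg T f n x)
  have h2 : ∫ x in A, M (T x) ∂μ ≤ ∫ x, M (T x) ∂μ :=
    setIntegral_le_integral hMT (ae_of_all _ fun x => maxBirkhoff_nonneg T f n _)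
  have h3 : ∫ x, M (T x) ∂μ = ∫ x, M x ∂μ := by
    have h4 := integral_map (μ := μ) hT.measurable.aemeasurable
      (f := M) (by rw [hT.map_eq]; exact hMi.aestronglyMeasurable)
    rw [hT.map_eq] at h4
    exact h4.symm
  have h5 : ∫ x in A, (M x - M (T x)) ∂μ ≤ ∫ x in A, f x ∂μ := by
    refine setIntegral_mono_on (hMi.sub hMT).integrableOn hf.integrableOn hA fun x hx => ?_
    have hx' : 0 < M x := hx
    have h6 : M x ≤ max 0 (f x + M (T x)) := maxBirkhoff_le_succ T f n x
    rcases le_max_iff.1 h6 with h | h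
    · exact absurd hx' (not_lt.2 h)
    · linarith
  rw [integral_sub hMi.integrableOn hMT.integrableOn] at h5
  linarith

theorem measurable_visits {T : α → α} (hT : Measurable T) {B : Set α} (hB : MeasurableSet B)
    (n : ℕ) : Measurable (visits T B n) :=
  Finset.measurable_fun_sum (f := fun k x => B.indicator (1 : α → ℝ) (T^[k] x))
    (Finset.range n) fun k _ => (measurable_one.indicator hB).comp (hT.iterate k)

/-- If `μ B < η`, a set of positive measure consists of points whose orbits visit `B` with
frequency at most `η` at all times. -/
theorem measure_forall_visits_le_pos [IsProbabilityMeasure μ] {T : α → α}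
    (hT : MeasurePreserving T μ μ) {B : Set α} (hB : MeasurableSet B) {η : ℝ}
    (hη : μ.real B < η) : μ {x | ∀ n : ℕ, visits T B n x ≤ η * n} ≠ 0 := by
  intro h0
  set f : α → ℝ := fun x => B.indicator 1 x - η with hf
  have hfi : Integrable f μ :=
    ((integrable_indicator_iff hB).2 (integrable_const (1 : ℝ)).integrableOn).sub
      (integrable_const η)
  have hfm : Measurable f := (measurable_one.indicator hB).sub measurable_const
  have hMm : ∀ n, Measurable (maxBirkhoff T f n) := by
    intro n
    induction n with
    | zero => exact measurable_const
    | succ n ih => exact measurable_const.max (hfm.add (ih.comp hT.measurable))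
  have hsum : ∀ n x, birkhoffSum T f n x = visits T B n x - η * n := by
    intro n x
    simp [visits, birkhoffSum, hf, Finset.sum_sub_distrib, mul_comm]
  set A : ℕ → Set α := fun n => {x | 0 < maxBirkhoff T f n x} with hAdef
  have hAm : ∀ n, MeasurableSet (A n) := fun n => measurableSet_lt measurable_const (hMm n)
  have hmono : Monotone A := monotone_nat_of_le_succ fun n x hx =>
    lt_of_lt_of_le hx (maxBirkhoff_le_succ T f n x)
  have hint : ∀ n, η * μ.real (A n) ≤ μ.real B := by
    intro n
    have h := setIntegral_maxBirkhoff_pos_nonneg hT hfi n (hAm n)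
    have h1 : ∫ x in A n, f x ∂μ = μ.real (B ∩ A n) - η * μ.real (A n) := by
      have h4 : IntegrableOn (B.indicator (1 : α → ℝ)) (A n) μ :=
        ((integrable_indicator_iff hB).2 (integrable_const (1 : ℝ)).integrableOn).integrableOn
      have h5 := integral_sub h4 (integrable_const (μ := μ.restrict (A n)) η)
      rw [integral_indicator_one hB, setIntegral_const, measureReal_restrict_apply hB,
        smul_eq_mul, mul_comm] at h5
      exact h5
    have h2 : μ.real (B ∩ A n) ≤ μ.real B := measureReal_mono Set.inter_subset_left
    have h3 : 0 ≤ ∫ x in A n, f x ∂μ := h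
    linarith
  have hfull : μ (⋃ n, A n) = 1 := by
    rw [← prob_compl_eq_zero_iff (MeasurableSet.iUnion hAm)]
    refine measure_mono_null (fun x hx => Set.mem_ofPred.2 fun n => ?_) h0
    have hx' : ¬ 0 < maxBirkhoff T f n x := fun h => hx (Set.mem_iUnion.2 ⟨n, h⟩)
    have := birkhoffSum_le_maxBirkhoff T f n x
    rw [hsum] at this
    linarith [not_lt.1 hx']
  have hlim : Tendsto (fun n => μ.real (A n)) atTop (𝓝 1) := by
    have := tendsto_measure_iUnion_atTop (μ := μ) hmono
    rw [hfull] at this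
    exact (ENNReal.tendsto_toReal ENNReal.one_ne_top).comp this
  have := le_of_tendsto (hlim.const_mul η) (Eventually.of_forall hint)
  linarith

/-- For an ergodic map and a set `B` with `μ B < η`, the visits to `B` up to time `n` are at most
`η n + C`, with a constant `C` that is uniform off a set of small measure. -/
theorem exists_measure_visits_gt_le [IsProbabilityMeasure μ] {T : α → α} (hT : Ergodic T μ)
    {B : Set α} (hB : MeasurableSet B) {η : ℝ} (hη : μ.real B < η) {δ : ℝ} (hδ : 0 < δ) :
    ∃ C : ℕ, μ.real {x | ∀ n : ℕ, visits T B n x ≤ η * n + C}ᶜ ≤ δ := by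
  set G : ℕ → Set α := fun C => {x | ∀ n : ℕ, visits T B n x ≤ η * n + C} with hG
  have hGm : ∀ C, MeasurableSet (G C) := fun C => by
    have : G C = ⋂ n : ℕ, {x | visits T B n x ≤ η * n + C} := by
      ext x
      simp [hG]
    rw [this]
    exact MeasurableSet.iInter fun n =>
      measurableSet_le (measurable_visits hT.measurable hB n) measurable_const
  have hη0 : 0 ≤ η := measureReal_nonneg.trans hη.le
  have hind : ∀ x, 0 ≤ B.indicator (1 : α → ℝ) x ∧ B.indicator (1 : α → ℝ) x ≤ 1 := fun x =>
    ⟨Set.indicator_nonneg (fun _ _ => zero_le_one) x,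
      Set.indicator_le_self' (fun _ _ => zero_le_one) x⟩
  -- The union of the `G C` is invariant and has positive measure, so it has full measure.
  have hinv : T ⁻¹' (⋃ C, G C) = ⋃ C, G C := by
    ext x
    simp only [Set.mem_preimage, Set.mem_iUnion]
    constructor
    · rintro ⟨C, hC⟩
      refine ⟨C + 1, fun n => ?_⟩
      cases n with
      | zero =>
        simp only [visits, birkhoffSum_zero]
        positivity
      | succ n =>
        rw [visits_succ]
        have h1 := hC n
        have h2 := (hind x).2
        push_cast
        linarith
    · rintro ⟨C, hC⟩
      obtain ⟨m, hm⟩ := exists_nat_ge η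
      refine ⟨C + m, fun n => ?_⟩
      have h1 := hC (n + 1)
      rw [visits_succ] at h1
      have h2 := (hind x).1
      push_cast at h1 ⊢
      linarith
  have hU : MeasurableSet (⋃ C, G C) := MeasurableSet.iUnion hGm
  have hfull : μ (⋃ C, G C) = 1 := by
    rcases hT.toPreErgodic.prob_eq_zero_or_one hU hinv with h | h
    · refine absurd (measure_mono_null ?_ h) (measure_forall_visits_le_pos
        hT.toMeasurePreserving hB hη)
      intro x hx
      exact Set.mem_iUnion.2 ⟨0, fun n => by simpa using hx n⟩
    · exact h
  have hmono : Monotone G := fun C C' h x hx n =>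
    (hx n).trans (by gcongr)
  have hlim : Tendsto (fun C => μ.real (G C)) atTop (𝓝 1) := by
    have := tendsto_measure_iUnion_atTop (μ := μ) hmono
    rw [hfull] at this
    exact (ENNReal.tendsto_toReal ENNReal.one_ne_top).comp this
  obtain ⟨C, hC⟩ := (hlim.eventually (lt_mem_nhds (show 1 - δ < 1 by linarith))).exists
  refine ⟨C, ?_⟩
  rw [probReal_compl_eq_one_sub (hGm C)]
  linarith

end Ergodic

/-! ### Lipschitz pieces of the upper bounding graph -/

section

variable {ρ κ : ℝ}

/-- The set of the `θ` whose preimage under the rotation has a value of the upper bounding graph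
below `x`. -/
def lowSet (ρ κ : ℝ) (hκ : 0 < κ) (x : ℝ) : Set UnitAddCircle :=
  {θ | (upperGraph ρ κ hκ (θ + -(ρ : UnitAddCircle)) : ℝ) < x}

theorem measurableSet_upperGraph_lt (hκ : 0 < κ) (x : ℝ) :
    MeasurableSet {θ | (upperGraph ρ κ hκ θ : ℝ) < x} :=
  measurableSet_lt (measurable_subtype_coe.comp (measurable_upperGraph hκ)) measurable_const

theorem measurableSet_lowSet (hκ : 0 < κ) (x : ℝ) : MeasurableSet (lowSet ρ κ hκ x) :=
  (measurePreserving_add_right volume (-(ρ : UnitAddCircle))).measurable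
    (measurableSet_upperGraph_lt hκ x)

theorem measureReal_lowSet (hκ : 0 < κ) (x : ℝ) :
    volume.real (lowSet ρ κ hκ x) = volume.real {θ | (upperGraph ρ κ hκ θ : ℝ) < x} := by
  have h := (measurePreserving_add_right volume (-(ρ : UnitAddCircle))).measure_preimage
    (measurableSet_upperGraph_lt (ρ := ρ) hκ x).nullMeasurableSet
  rw [measureReal_def, measureReal_def, ← h]
  rfl

/-- A bound for the factor by which the fibre maps along the first `k` backward steps of `θ` and
`θ'` change distances: every step contributes a factor `κ⁻¹`, and a further factor `κ ^ 2` for each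
of the two points that is low. -/
noncomputable def contractionBound (ρ κ : ℝ) (hκ : 0 < κ) (x : ℝ) (k : ℕ)
    (θ θ' : UnitAddCircle) : ℝ :=
  Real.exp (Real.log κ * (2 * (visits (· + -(ρ : UnitAddCircle)) (lowSet ρ κ hκ x) k θ +
    visits (· + -(ρ : UnitAddCircle)) (lowSet ρ κ hκ x) k θ') - k))

theorem contractionBound_nonneg (hκ : 0 < κ) (x : ℝ) (k : ℕ) (θ θ' : UnitAddCircle) :
    0 ≤ contractionBound ρ κ hκ x k θ θ' := (Real.exp_pos _).le

theorem contractionBound_zero (hκ : 0 < κ) (x : ℝ) (θ θ' : UnitAddCircle) :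
    contractionBound ρ κ hκ x 0 θ θ' = 1 := by
  simp [contractionBound, visits]

theorem contractionBound_succ (hκ : 0 < κ) (x : ℝ) (k : ℕ) (θ θ' : UnitAddCircle) :
    contractionBound ρ κ hκ x (k + 1) θ θ' = contractionBound ρ κ hκ x 1 θ θ' *
      contractionBound ρ κ hκ x k (θ + -(ρ : UnitAddCircle)) (θ' + -(ρ : UnitAddCircle)) := by
  rw [contractionBound, contractionBound, contractionBound, ← Real.exp_add,
    visits_succ, visits_succ, visits_one, visits_one]
  congr 1
  push_cast
  ring

/-- One step of the fibre map contracts by `κ⁻¹` if both values are at least `x`, and expands by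
at most `κ` in any case. -/
theorem abs_upperGraph_sub_le_step (hκ : 0 < κ) (hκ1 : 1 ≤ κ) {x : ℝ} (hx : 0 ≤ x)
    (hcosh : κ ≤ Real.cosh (κ * x)) (θ θ' : UnitAddCircle) :
    |(upperGraph ρ κ hκ θ : ℝ) - upperGraph ρ κ hκ θ'| ≤ Real.pi * dist θ θ' +
      contractionBound ρ κ hκ x 1 θ θ' *
        |(upperGraph ρ κ hκ (θ + -(ρ : UnitAddCircle)) : ℝ) -
          upperGraph ρ κ hκ (θ' + -(ρ : UnitAddCircle))| := by
  set T : UnitAddCircle → UnitAddCircle := (· + -(ρ : UnitAddCircle)) with hT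
  set a : ℝ := ((upperGraph ρ κ hκ (T θ) : unitInterval) : ℝ) with ha
  set b : ℝ := ((upperGraph ρ κ hκ (T θ') : unitInterval) : ℝ) with hb
  have ha0 : 0 ≤ a := (upperGraph ρ κ hκ (T θ)).2.1
  have hb0 : 0 ≤ b := (upperGraph ρ κ hκ (T θ')).2.1
  have e1 : (upperGraph ρ κ hκ θ : ℝ) = Real.tanh (κ * a) * forcing (T θ) := by
    rw [ha, ← upperGraph_add, hT]
    simp
  have e2 : (upperGraph ρ κ hκ θ' : ℝ) = Real.tanh (κ * b) * forcing (T θ') := by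
    rw [hb, ← upperGraph_add, hT]
    simp
  have hdist : dist (T θ) (T θ') = dist θ θ' := dist_add_right _ _ _
  have hs := abs_forcing_sub_forcing_le (T θ) (T θ')
  rw [hdist] at hs
  have hts : |Real.tanh (κ * b)| ≤ 1 := (Real.abs_tanh_lt_one _).le
  have hlog : 0 ≤ Real.log κ := Real.log_nonneg hκ1
  have htanh : |Real.tanh (κ * a) - Real.tanh (κ * b)| ≤
      contractionBound ρ κ hκ x 1 θ θ' * |a - b| := by
    have hmul : |κ * a - κ * b| = κ * |a - b| := by
      rw [← mul_sub, abs_mul, abs_of_pos hκ]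
    have hind : ∀ y, 0 ≤ (lowSet ρ κ hκ x).indicator (1 : UnitAddCircle → ℝ) y := fun y =>
      Set.indicator_nonneg (fun _ _ => zero_le_one) y
    by_cases hlow : θ ∈ lowSet ρ κ hκ x ∨ θ' ∈ lowSet ρ κ hκ x
    · have h1 := abs_tanh_sub_tanh_le le_rfl (mul_nonneg hκ.le ha0) (mul_nonneg hκ.le hb0)
      rw [Real.cosh_zero, hmul] at h1
      have h2 : κ ≤ contractionBound ρ κ hκ x 1 θ θ' := by
        rw [contractionBound, visits_one, visits_one]
        conv_lhs => rw [← Real.exp_log hκ]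
        refine Real.exp_le_exp.2 (le_mul_of_one_le_right hlog ?_)
        have h3 := hind θ
        have h4 := hind θ'
        rcases hlow with h | h
        · have h5 := Set.indicator_of_mem h (1 : UnitAddCircle → ℝ)
          rw [h5, Pi.one_apply]
          push_cast
          linarith
        · have h5 := Set.indicator_of_mem h (1 : UnitAddCircle → ℝ)
          rw [h5, Pi.one_apply]
          push_cast
          linarith
      have h6 := mul_le_mul_of_nonneg_right h2 (abs_nonneg (a - b))
      linarith
    · rw [not_or] at hlow
      have hxa : x ≤ a := not_lt.1 hlow.1
      have hxb : x ≤ b := not_lt.1 hlow.2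
      have h1 := abs_tanh_sub_tanh_le (mul_nonneg hκ.le hx)
        (mul_le_mul_of_nonneg_left hxa hκ.le) (mul_le_mul_of_nonneg_left hxb hκ.le)
      have h2 : contractionBound ρ κ hκ x 1 θ θ' = κ⁻¹ := by
        rw [contractionBound, visits_one, visits_one, Set.indicator_of_notMem hlow.1,
          Set.indicator_of_notMem hlow.2]
        simp [Real.exp_neg, Real.exp_log hκ]
      rw [h2]
      rw [hmul, ← mul_assoc] at h1
      refine h1.trans (mul_le_mul_of_nonneg_right ?_ (abs_nonneg _))
      have hc := Real.cosh_pos (κ * x)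
      rw [inv_eq_one_div, div_mul_eq_mul_div, one_mul, div_le_div_iff₀ (by positivity) hκ]
      nlinarith
  have hsplit : (upperGraph ρ κ hκ θ : ℝ) - upperGraph ρ κ hκ θ' =
      (Real.tanh (κ * a) - Real.tanh (κ * b)) * forcing (T θ) +
        Real.tanh (κ * b) * (forcing (T θ) - forcing (T θ')) := by
    rw [e1, e2]
    ring
  rw [hsplit]
  refine (abs_add_le _ _).trans ?_
  rw [abs_mul, abs_mul, abs_of_nonneg (forcing_nonneg _)]
  have h7 := mul_le_of_le_one_right (abs_nonneg (Real.tanh (κ * a) - Real.tanh (κ * b)))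
    (forcing_le_one (T θ))
  have h8 := mul_le_of_le_one_left (abs_nonneg (forcing (T θ) - forcing (T θ'))) hts
  linarith

theorem abs_upperGraph_sub_le_sum (hκ : 0 < κ) (hκ1 : 1 ≤ κ) {x : ℝ} (hx : 0 ≤ x)
    (hcosh : κ ≤ Real.cosh (κ * x)) (n : ℕ) (θ θ' : UnitAddCircle) :
    |(upperGraph ρ κ hκ θ : ℝ) - upperGraph ρ κ hκ θ'| ≤
      Real.pi * dist θ θ' * ∑ k ∈ Finset.range n, contractionBound ρ κ hκ x k θ θ' +
        contractionBound ρ κ hκ x n θ θ' := by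
  induction n generalizing θ θ' with
  | zero =>
    have h1 := (upperGraph ρ κ hκ θ).2
    have h2 := (upperGraph ρ κ hκ θ').2
    simp only [Finset.range_zero, Finset.sum_empty, mul_zero, zero_add]
    rw [contractionBound_zero, abs_le]
    constructor <;> linarith [h1.1, h1.2, h2.1, h2.2]
  | succ n ih =>
    have h1 := abs_upperGraph_sub_le_step hκ hκ1 hx hcosh (ρ := ρ) θ θ'
    have h2 := ih (θ + -(ρ : UnitAddCircle)) (θ' + -(ρ : UnitAddCircle))
    have h3 := mul_le_mul_of_nonneg_left h2
      (contractionBound_nonneg (ρ := ρ) hκ x 1 θ θ')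
    refine h1.trans ((add_le_add le_rfl h3).trans (le_of_eq ?_))
    rw [Finset.sum_range_succ', contractionBound_zero, contractionBound_succ hκ x n,
      Finset.sum_congr rfl fun k _ => contractionBound_succ hκ x k θ θ', ← Finset.mul_sum,
      dist_add_right]
    ring

/-- The upper bounding graph is Lipschitz on the set of points whose backward orbits are low with
frequency at most `1 / 8`, up to the constant `C`. -/
theorem exists_lipschitz_upperGraph (hκ : 0 < κ) (hκ1 : 1 < κ) {x : ℝ} (hx : 0 ≤ x)
    (hcosh : κ ≤ Real.cosh (κ * x)) (C : ℕ) :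
    ∃ K : ℝ, ∀ θ ∈ {θ | ∀ n : ℕ, visits (· + -(ρ : UnitAddCircle)) (lowSet ρ κ hκ x) n θ ≤
        1 / 8 * n + C},
      ∀ θ' ∈ {θ | ∀ n : ℕ, visits (· + -(ρ : UnitAddCircle)) (lowSet ρ κ hκ x) n θ ≤
        1 / 8 * n + C},
      |(upperGraph ρ κ hκ θ : ℝ) - upperGraph ρ κ hκ θ'| ≤ K * dist θ θ' := by
  have hlog : 0 < Real.log κ := Real.log_pos hκ1
  set r : ℝ := Real.exp (-(Real.log κ / 2)) with hr
  have hr0 : 0 ≤ r := (Real.exp_pos _).le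
  have hr1 : r < 1 := (Real.exp_lt_exp.2 (by linarith)).trans_eq Real.exp_zero
  set M : ℝ := Real.exp (Real.log κ * (4 * C)) with hM
  refine ⟨Real.pi * (M * (1 - r)⁻¹), fun θ hθ θ' hθ' => ?_⟩
  -- Each low step costs at most two, and there are at most `k / 4 + 2 C` of them for the pair.
  have hb : ∀ k, contractionBound ρ κ hκ x k θ θ' ≤ M * r ^ k := by
    intro k
    rw [contractionBound, hM, hr, ← Real.exp_nat_mul, ← Real.exp_add]
    refine Real.exp_le_exp.2 ?_
    have h1 := hθ k
    have h2 := hθ' k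
    have h3 : Real.log κ * (4 * C) + k * -(Real.log κ / 2) = Real.log κ * (4 * C - k / 2) := by
      ring
    rw [h3]
    refine mul_le_mul_of_nonneg_left ?_ hlog.le
    linarith
  have hsum : ∀ n, ∑ k ∈ Finset.range n, contractionBound ρ κ hκ x k θ θ' ≤ M * (1 - r)⁻¹ := by
    intro n
    refine (Finset.sum_le_sum fun k _ => hb k).trans ?_
    rw [← Finset.mul_sum, ← tsum_geometric_of_lt_one hr0 hr1]
    exact mul_le_mul_of_nonneg_left ((summable_geometric_of_lt_one hr0 hr1).sum_le_tsum _
      fun _ _ => pow_nonneg hr0 _) (Real.exp_pos _).le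
  have hn : ∀ n : ℕ, |(upperGraph ρ κ hκ θ : ℝ) - upperGraph ρ κ hκ θ'| ≤
      Real.pi * (M * (1 - r)⁻¹) * dist θ θ' + M * r ^ n := by
    intro n
    refine (abs_upperGraph_sub_le_sum hκ hκ1.le hx hcosh n θ θ').trans ?_
    have h1 := mul_le_mul_of_nonneg_left (hsum n)
      (mul_nonneg Real.pi_pos.le (dist_nonneg : 0 ≤ dist θ θ'))
    have h2 := hb n
    linarith
  have hlim : Tendsto (fun n : ℕ => Real.pi * (M * (1 - r)⁻¹) * dist θ θ' + M * r ^ n) atTop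
      (𝓝 (Real.pi * (M * (1 - r)⁻¹) * dist θ θ' + M * 0)) :=
    ((tendsto_pow_atTop_nhds_zero_of_lt_one hr0 hr1).const_mul M).const_add _
  rw [mul_zero, add_zero] at hlim
  exact ge_of_tendsto' hlim hn

end

/-! ### Entropy of grid partitions of a graph -/

section Entropy

theorem measurable_rep : Measurable rep :=
  measurable_subtype_coe.comp (AddCircle.measurableEquivIco (1 : ℝ) 0).measurable

theorem dist_le_abs_rep_sub (θ θ' : UnitAddCircle) : dist θ θ' ≤ |rep θ - rep θ'| := by
  rw [dist_eq_norm]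
  conv_lhs => rw [← coe_rep θ, ← coe_rep θ', ← AddCircle.coe_sub]
  rw [UnitAddCircle.norm_eq]
  simpa using round_le (rep θ - rep θ') 0

/-- Gibbs' inequality: the entropy of a partition is at most its cross entropy with respect to
arbitrary positive weights, up to the deviation of their total mass from one. -/
theorem integral_neg_log_measure_fiber_le {α ι : Type*} [MeasurableSpace α] {μ : Measure α}
    [IsProbabilityMeasure μ] [Fintype ι] [MeasurableSpace ι] [MeasurableSingletonClass ι]
    {h : α → ι} (hh : Measurable h) {w : ι → ℝ} (hw : ∀ i, 0 < w i) :
    ∫ x, -Real.log (μ.real (h ⁻¹' {h x})) ∂μ ≤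
      ∫ x, -Real.log (w (h x)) ∂μ + (∑ i, w i - 1) := by
  have := Measure.isProbabilityMeasure_map (μ := μ) hh.aemeasurable
  have key : ∀ f : ι → ℝ, ∫ x, f (h x) ∂μ = ∑ i, μ.real (h ⁻¹' {i}) * f i := by
    intro f
    rw [← integral_map hh.aemeasurable (Integrable.of_finite (f := f)).aestronglyMeasurable,
      integral_fintype Integrable.of_finite]
    refine Finset.sum_congr rfl fun i _ => ?_
    rw [map_measureReal_apply hh (measurableSet_singleton i), smul_eq_mul]
  have h1 : ∑ i, μ.real (h ⁻¹' {i}) = 1 := by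
    have := key fun _ => 1
    simpa using this.symm
  rw [key fun i => -Real.log (μ.real (h ⁻¹' {i})), key fun i => -Real.log (w i), ← h1,
    ← Finset.sum_sub_distrib, ← Finset.sum_add_distrib]
  refine Finset.sum_le_sum fun i _ => ?_
  rcases (measureReal_nonneg (μ := μ) (s := h ⁻¹' {i})).eq_or_lt with h0 | h0
  · rw [← h0]
    linarith [hw i]
  · have h2 := Real.log_le_sub_one_of_pos (div_pos (hw i) h0)
    rw [Real.log_div (hw i).ne' h0.ne'] at h2
    have h3 := mul_le_mul_of_nonneg_left h2 h0.le
    have h4 : μ.real (h ⁻¹' {i}) * (w i / μ.real (h ⁻¹' {i}) - 1) =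
        w i - μ.real (h ⁻¹' {i}) := by
      field_simp
    linarith

theorem ae_measure_fiber_pos {α ι : Type*} [MeasurableSpace α] {μ : Measure α}
    [IsProbabilityMeasure μ] [Finite ι] (h : α → ι) :
    ∀ᵐ x ∂μ, 0 < μ.real (h ⁻¹' {h x}) := by
  have h1 : ∀ i, ∀ᵐ x ∂μ, h x = i → 0 < μ.real (h ⁻¹' {i}) := by
    intro i
    rcases (measureReal_nonneg (μ := μ) (s := h ⁻¹' {i})).eq_or_lt with h0 | h0
    · have h2 : μ (h ⁻¹' {i}) = 0 := (measureReal_eq_zero_iff).1 h0.symm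
      filter_upwards [measure_eq_zero_iff_ae_notMem.1 h2] with x hx hxi
      exact absurd hxi hx
    · exact ae_of_all _ fun _ _ => h0
  filter_upwards [ae_all_iff.2 h1] with x hx
  exact hx _ rfl

/-- The cell of the grid of mesh `1 / N` that contains the point of the graph of `φ` over `θ`. -/
noncomputable def gridCell (φ : UnitAddCircle → unitInterval) (N : ℕ) [NeZero N]
    (θ : UnitAddCircle) : Fin N × Fin (N + 1) :=
  (⟨⌊N * rep θ⌋₊, (Nat.floor_lt (mul_nonneg N.cast_nonneg (rep_nonneg θ))).2
      (mul_lt_of_lt_one_right (Nat.cast_pos.2 (NeZero.pos N)) (rep_lt_one θ))⟩,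
    ⟨⌊N * (φ θ : ℝ)⌋₊, Nat.lt_succ_of_le (Nat.floor_le_of_le
      (mul_le_of_le_one_right N.cast_nonneg (φ θ).2.2))⟩)

variable {φ : UnitAddCircle → unitInterval}

theorem measurable_gridCell (hφ : Measurable φ) (N : ℕ) [NeZero N] :
    Measurable (gridCell φ N) := by
  refine Measurable.prodMk ?_ ?_
  · refine measurable_to_countable' fun i => ?_
    have : Measurable fun θ => ⌊N * rep θ⌋₊ := (measurable_rep.const_mul _).nat_floor
    convert this (measurableSet_singleton (i : ℕ)) using 1
    ext θ
    simp [Fin.ext_iff]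
  · refine measurable_to_countable' fun i => ?_
    have : Measurable fun θ => ⌊N * (φ θ : ℝ)⌋₊ :=
      ((measurable_subtype_coe.comp hφ).const_mul _).nat_floor
    convert this (measurableSet_singleton (i : ℕ)) using 1
    ext θ
    simp [Fin.ext_iff]

theorem abs_sub_lt_one_of_floor_eq {x y : ℝ} (hx : 0 ≤ x) (hy : 0 ≤ y) (h : ⌊x⌋₊ = ⌊y⌋₊) :
    |x - y| < 1 := by
  have h1 := Nat.floor_le hx
  have h2 := Nat.lt_floor_add_one x
  have h3 := Nat.floor_le hy
  have h4 := Nat.lt_floor_add_one y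
  rw [h] at h1 h2
  rw [abs_lt]
  constructor <;> linarith

theorem dist_lt_of_fst_gridCell_eq {N : ℕ} [NeZero N] {θ θ' : UnitAddCircle}
    (h : (gridCell φ N θ).1 = (gridCell φ N θ').1) : N * dist θ θ' < 1 := by
  have hN : (0 : ℝ) ≤ N := N.cast_nonneg
  have h1 := abs_sub_lt_one_of_floor_eq (mul_nonneg hN (rep_nonneg θ))
    (mul_nonneg hN (rep_nonneg θ')) (congrArg Fin.val h)
  rw [← mul_sub, abs_mul, abs_of_nonneg hN] at h1
  exact (mul_le_mul_of_nonneg_left (dist_le_abs_rep_sub θ θ') hN).trans_lt h1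

theorem dist_lt_of_gridCell_eq {N : ℕ} [NeZero N] {θ θ' : UnitAddCircle}
    (h : gridCell φ N θ = gridCell φ N θ') : dist (θ, φ θ) (θ', φ θ') < 1 / N := by
  have hN : (0 : ℝ) < N := Nat.cast_pos.2 (NeZero.pos N)
  rw [Prod.dist_eq, max_lt_iff, lt_div_iff₀' hN, lt_div_iff₀' hN]
  refine ⟨dist_lt_of_fst_gridCell_eq (congrArg Prod.fst h), ?_⟩
  have h1 := abs_sub_lt_one_of_floor_eq (mul_nonneg hN.le (φ θ).2.1)
    (mul_nonneg hN.le (φ θ').2.1) (congrArg Fin.val (congrArg Prod.snd h))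
  rwa [← mul_sub, abs_mul, abs_of_nonneg hN.le] at h1

/-- A grid of mesh `1 / N` has at most `(K + 2) N` cells that meet a `K`-Lipschitz piece of the
graph. -/
theorem card_gridCell_image_le {E : Set UnitAddCircle} {K : ℝ} (hK : 0 ≤ K)
    (hE : ∀ θ ∈ E, ∀ θ' ∈ E, |(φ θ : ℝ) - φ θ'| ≤ K * dist θ θ') (N : ℕ) [NeZero N]
    (S : Finset (Fin N × Fin (N + 1))) (hS : ∀ i ∈ S, ∃ θ ∈ E, gridCell φ N θ = i) :
    (S.card : ℝ) ≤ (K + 2) * N := by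
  have hfib : ∀ i ∈ S.image Prod.fst, (S.filter fun x => x.1 = i).card ≤ ⌊K + 1⌋₊ + 1 := by
    intro i _
    set R : Finset ℕ := (S.filter fun x => x.1 = i).image fun x => (x.2 : ℕ) with hR
    have hcard : (S.filter fun x => x.1 = i).card = R.card := by
      refine (Finset.card_image_of_injOn ?_).symm
      intro x hx y hy hxy
      have hx' := (Finset.mem_filter.1 hx).2
      have hy' := (Finset.mem_filter.1 hy).2
      exact Prod.ext (hx'.trans hy'.symm) (Fin.ext hxy)
    rw [hcard]
    rcases R.eq_empty_or_nonempty with hempty | hne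
    · simp [hempty]
    have hsub : R ⊆ Finset.Icc (R.min' hne) (R.min' hne + ⌊K + 1⌋₊) := by
      intro j hj
      refine Finset.mem_Icc.2 ⟨R.min'_le j hj, ?_⟩
      obtain ⟨x, hx, hxj⟩ := Finset.mem_image.1 hj
      obtain ⟨y, hy, hyj⟩ := Finset.mem_image.1 (R.min'_mem hne)
      obtain ⟨hxS, hxi⟩ := Finset.mem_filter.1 hx
      obtain ⟨hyS, hyi⟩ := Finset.mem_filter.1 hy
      obtain ⟨θ, hθ, rfl⟩ := hS x hxS
      obtain ⟨θ', hθ', rfl⟩ := hS y hyS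
      have hN : (0 : ℝ) ≤ N := N.cast_nonneg
      have h1 := dist_lt_of_fst_gridCell_eq (hxi.trans hyi.symm)
      have h2 := mul_le_mul_of_nonneg_left ((le_abs_self _).trans (hE θ hθ θ' hθ')) hN
      have h3 := mul_le_mul_of_nonneg_left h1.le hK
      have h4 : (j : ℝ) ≤ N * (φ θ : ℝ) := by
        rw [← hxj]
        exact Nat.floor_le (mul_nonneg hN (φ θ).2.1)
      have h5 : N * (φ θ' : ℝ) < (R.min' hne : ℝ) + 1 := by
        rw [← hyj]
        exact Nat.lt_floor_add_one _
      have h6 : (j : ℝ) - R.min' hne ≤ K + 1 := by linarith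
      have h7 : j - R.min' hne ≤ ⌊K + 1⌋₊ := by
        refine Nat.le_floor ?_
        rwa [Nat.cast_sub (R.min'_le j hj)]
      omega
    have := Finset.card_le_card hsub
    rw [Nat.card_Icc] at this
    omega
  have h1 := Finset.card_le_mul_card_image S _ hfib
  have h2 : (S.image Prod.fst).card ≤ N := by
    simpa using Finset.card_le_univ (S.image Prod.fst)
  have h3 : (S.card : ℝ) ≤ (⌊K + 1⌋₊ + 1) * N := by
    exact_mod_cast h1.trans (Nat.mul_le_mul_left _ h2)
  have h4 := Nat.floor_le (show 0 ≤ K + 1 by linarith)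
  refine h3.trans (mul_le_mul_of_nonneg_right (by linarith) N.cast_nonneg)

/-- The entropy of the grid partition is at most `log N`, up to a constant and up to a multiple
of `log N` that is small with the measure of the set on which the graph is not Lipschitz. -/
theorem entropy_gridCell_le (hφ : Measurable φ) {E : Set UnitAddCircle} {K δ : ℝ} (hK : 0 ≤ K)
    (hE : ∀ θ ∈ E, ∀ θ' ∈ E, |(φ θ : ℝ) - φ θ'| ≤ K * dist θ θ')
    (hδ : volume.real Eᶜ ≤ δ) (N : ℕ) [NeZero N] :
    ∫ θ, -Real.log (volume.real (gridCell φ N ⁻¹' {gridCell φ N θ})) ≤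
      1 + Real.log ((K + 2) * N) + δ * Real.log (2 * N ^ 2) := by
  classical
  set S : Finset (Fin N × Fin (N + 1)) :=
    Finset.univ.filter fun i => ∃ θ ∈ E, gridCell φ N θ = i with hSdef
  have hN1 : (1 : ℝ) ≤ N := Nat.one_le_cast.2 (NeZero.pos N)
  have hN : (0 : ℝ) < N := one_pos.trans_le hN1
  have hA : 1 ≤ (K + 2) * N := by nlinarith
  have hA0 : 0 < (K + 2) * N := one_pos.trans_le hA
  have hD : 1 ≤ 2 * (N : ℝ) ^ 2 := by nlinarith
  have hD0 : 0 < 2 * (N : ℝ) ^ 2 := one_pos.trans_le hD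
  -- Weights of total mass at most two: uniform on the cells that meet the Lipschitz piece, and
  -- uniform on the whole grid, of `N (N + 1) ≤ 2 N ^ 2` cells, elsewhere.
  set w : Fin N × Fin (N + 1) → ℝ := fun i =>
    if i ∈ S then ((K + 2) * N)⁻¹ else (2 * (N : ℝ) ^ 2)⁻¹ with hw
  have hw0 : ∀ i, 0 < w i := fun i => by
    simp only [hw]
    split_ifs
    · exact inv_pos.2 hA0
    · exact inv_pos.2 hD0
  have hcard : (S.card : ℝ) ≤ (K + 2) * N :=
    card_gridCell_image_le hK hE N S fun i hi => (Finset.mem_filter.1 hi).2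
  have hsum : ∑ i, w i ≤ 2 := by
    have h1 : ∑ i, w i ≤ ∑ i, ((if i ∈ S then ((K + 2) * N)⁻¹ else 0) + (2 * (N : ℝ) ^ 2)⁻¹) := by
      refine Finset.sum_le_sum fun i _ => ?_
      simp only [hw]
      split_ifs
      · linarith [inv_pos.2 hD0]
      · linarith
    rw [Finset.sum_add_distrib, Finset.sum_ite_mem, Finset.univ_inter, Finset.sum_const,
      Finset.sum_const, Finset.card_univ, Fintype.card_prod, Fintype.card_fin, Fintype.card_fin,
      nsmul_eq_mul, nsmul_eq_mul] at h1
    have h2 : (S.card : ℝ) * ((K + 2) * N)⁻¹ ≤ 1 := by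
      rw [← div_eq_mul_inv]
      exact (div_le_one hA0).2 hcard
    have h3 : ((N * (N + 1) : ℕ) : ℝ) * (2 * (N : ℝ) ^ 2)⁻¹ ≤ 1 := by
      rw [← div_eq_mul_inv, div_le_one hD0]
      push_cast
      nlinarith
    linarith
  have hm := measurable_gridCell hφ N
  have hbadm : MeasurableSet (gridCell φ N ⁻¹' (S : Set (Fin N × Fin (N + 1)))ᶜ) :=
    hm (Set.toFinite _).measurableSet
  have hbad : volume.real (gridCell φ N ⁻¹' (S : Set (Fin N × Fin (N + 1)))ᶜ) ≤ δ := by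
    refine le_trans (measureReal_mono ?_) hδ
    intro θ hθ hθE
    exact hθ (Finset.mem_coe.2 (Finset.mem_filter.2 ⟨Finset.mem_univ _, θ, hθE, rfl⟩))
  have hint : ∫ θ, -Real.log (w (gridCell φ N θ)) ≤
      Real.log ((K + 2) * N) + δ * Real.log (2 * N ^ 2) := by
    have hind : Integrable ((gridCell φ N ⁻¹' (S : Set (Fin N × Fin (N + 1)))ᶜ).indicator
        fun _ => Real.log (2 * (N : ℝ) ^ 2)) := (integrable_const _).indicator hbadm
    have h1 : ∫ θ, -Real.log (w (gridCell φ N θ)) ≤ ∫ θ, (Real.log ((K + 2) * N) +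
        (gridCell φ N ⁻¹' (S : Set (Fin N × Fin (N + 1)))ᶜ).indicator
          (fun _ => Real.log (2 * (N : ℝ) ^ 2)) θ) := by
      refine integral_mono ?_ ((integrable_const _).add hind) fun θ => ?_
      · have := Measure.isProbabilityMeasure_map
          (μ := (volume : Measure UnitAddCircle)) hm.aemeasurable
        exact (Integrable.of_finite (f := fun i => -Real.log (w i))
          (μ := Measure.map (gridCell φ N) volume)).comp_measurable hm
      · by_cases hθ : gridCell φ N θ ∈ S
        · have h2 : 0 ≤ (gridCell φ N ⁻¹' (S : Set (Fin N × Fin (N + 1)))ᶜ).indicator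
              (fun _ => Real.log (2 * (N : ℝ) ^ 2)) θ :=
            Set.indicator_nonneg (fun _ _ => Real.log_nonneg hD) θ
          simp only [hw, if_pos hθ, Real.log_inv, neg_neg]
          linarith
        · have hθ' : θ ∈ gridCell φ N ⁻¹' (S : Set (Fin N × Fin (N + 1)))ᶜ := hθ
          simp only [hw, if_neg hθ, Real.log_inv, neg_neg]
          rw [Set.indicator_of_mem hθ']
          linarith [Real.log_nonneg hA]
    refine h1.trans ?_
    rw [integral_add (integrable_const _) hind, integral_indicator_const _ hbadm, smul_eq_mul]
    simp only [integral_const, probReal_univ, smul_eq_mul, one_mul]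
    linarith [mul_le_mul_of_nonneg_right hbad (Real.log_nonneg hD)]
  have h := integral_neg_log_measure_fiber_le hm hw0 (μ := (volume : Measure UnitAddCircle))
  linarith

end Entropy

/-! ### Information dimension of graph measures -/

section InfoDim

theorem infoRatio_eq_neg_div_neg {X : Type*} [MetricSpace X] [MeasurableSpace X] (μ : Measure X)
    (ε : ℝ) : infoRatio μ ε =
      (-∫ x, Real.log (μ.real (Metric.ball x ε)) ∂μ) / -Real.log ε :=
  (neg_div_neg_eq _ _).symm

theorem measurable_log_measure_ball {X : Type*} [MetricSpace X] [MeasurableSpace X]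
    [BorelSpace X] [SecondCountableTopology X] (μ : Measure X) [IsProbabilityMeasure μ] (ε : ℝ) :
    Measurable fun x => Real.log (μ.real (Metric.ball x ε)) := by
  have hs : MeasurableSet {p : X × X | dist p.2 p.1 < ε} :=
    (isOpen_lt (continuous_snd.dist continuous_fst) continuous_const).measurableSet
  exact Real.measurable_log.comp (measurable_measure_prodMk_left (ν := μ) hs).ennreal_toReal

variable {φ : UnitAddCircle → unitInterval}

theorem measurable_graph (hφ : Measurable φ) : Measurable fun θ => (θ, φ θ) :=
  measurable_id.prodMk hφ

theorem isProbabilityMeasure_graphMeasure (hφ : Measurable φ) :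
    IsProbabilityMeasure (graphMeasure φ) :=
  Measure.isProbabilityMeasure_map (measurable_graph hφ).aemeasurable

theorem graphMeasure_ball (hφ : Measurable φ) (θ : UnitAddCircle) (ε : ℝ) :
    (graphMeasure φ).real (Metric.ball (θ, φ θ) ε) =
      volume.real {θ' | dist (θ', φ θ') (θ, φ θ) < ε} :=
  map_measureReal_apply (measurable_graph hφ) Metric.isOpen_ball.measurableSet

/-- A ball around a point of the graph projects into an interval of length `2 ε`. -/
theorem graphMeasure_ball_le (hφ : Measurable φ) (θ : UnitAddCircle) {ε : ℝ} (hε : 0 < ε) :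
    (graphMeasure φ).real (Metric.ball (θ, φ θ) ε) ≤ 2 * ε := by
  rw [graphMeasure_ball hφ]
  have h1 : {θ' | dist (θ', φ θ') (θ, φ θ) < ε} ⊆ Metric.closedBall θ ε := fun θ' h =>
    Metric.mem_closedBall.2 ((le_max_left (dist θ' θ) (dist (φ θ') (φ θ))).trans_lt h).le
  refine (measureReal_mono h1).trans ?_
  rw [measureReal_def, AddCircle.volume_closedBall]
  exact ENNReal.toReal_le_of_le_ofReal (by positivity)
    (ENNReal.ofReal_le_ofReal (min_le_right _ _))

theorem measure_gridCell_le_graphMeasure_ball (hφ : Measurable φ) {N : ℕ} [NeZero N] {ε : ℝ}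
    (hN : 1 / N ≤ ε) (θ : UnitAddCircle) :
    volume.real (gridCell φ N ⁻¹' {gridCell φ N θ}) ≤
      (graphMeasure φ).real (Metric.ball (θ, φ θ) ε) := by
  rw [graphMeasure_ball hφ]
  exact measureReal_mono fun θ' h => (dist_lt_of_gridCell_eq h).trans_le hN

/-- The integral in the information dimension exists and lies between the trivial bound
`-log (2 ε)` and the entropy of a grid partition of mesh at most `ε`. -/
theorem integral_neg_log_ball_bounds (hφ : Measurable φ) {N : ℕ} [NeZero N] {ε : ℝ} (hε : 0 < ε)
    (hN : 1 / N ≤ ε) :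
    Integrable (fun x => Real.log ((graphMeasure φ).real (Metric.ball x ε))) (graphMeasure φ) ∧
      -Real.log (2 * ε) ≤
        -∫ x, Real.log ((graphMeasure φ).real (Metric.ball x ε)) ∂graphMeasure φ ∧
      -∫ x, Real.log ((graphMeasure φ).real (Metric.ball x ε)) ∂graphMeasure φ ≤
        ∫ θ, -Real.log (volume.real (gridCell φ N ⁻¹' {gridCell φ N θ})) := by
  have := isProbabilityMeasure_graphMeasure hφ
  have hgm := measurable_log_measure_ball (graphMeasure φ) ε
  set g : UnitAddCircle → ℝ :=
    fun θ => Real.log ((graphMeasure φ).real (Metric.ball (θ, φ θ) ε)) with hg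
  have hcell : Integrable fun θ => Real.log (volume.real (gridCell φ N ⁻¹' {gridCell φ N θ})) := by
    have hm := measurable_gridCell hφ N
    have := Measure.isProbabilityMeasure_map
      (μ := (volume : Measure UnitAddCircle)) hm.aemeasurable
    exact (Integrable.of_finite (f := fun i => Real.log (volume.real (gridCell φ N ⁻¹' {i})))
      (μ := Measure.map (gridCell φ N) volume)).comp_measurable hm
  have hlow : ∀ᵐ θ, Real.log (volume.real (gridCell φ N ⁻¹' {gridCell φ N θ})) ≤ g θ := by
    filter_upwards [ae_measure_fiber_pos (gridCell φ N)] with θ hθ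
    exact Real.log_le_log hθ (measure_gridCell_le_graphMeasure_ball hφ hN θ)
  have hup : ∀ᵐ θ, g θ ≤ Real.log (2 * ε) := by
    filter_upwards [ae_measure_fiber_pos (gridCell φ N)] with θ hθ
    exact Real.log_le_log (hθ.trans_le (measure_gridCell_le_graphMeasure_ball hφ hN θ))
      (graphMeasure_ball_le hφ θ hε)
  have hgi : Integrable g :=
    integrable_of_le_of_le (hgm.comp (measurable_graph hφ)).aestronglyMeasurable hlow hup hcell
      (integrable_const _)
  have heq : ∫ x, Real.log ((graphMeasure φ).real (Metric.ball x ε)) ∂graphMeasure φ =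
      ∫ θ, g θ :=
    integral_map (measurable_graph hφ).aemeasurable hgm.aestronglyMeasurable
  refine ⟨(integrable_map_measure hgm.aestronglyMeasurable
    (measurable_graph hφ).aemeasurable).2 hgi, ?_, ?_⟩
  · rw [heq, neg_le_neg_iff]
    have := integral_mono_ae hgi (integrable_const (Real.log (2 * ε))) hup
    simpa using this
  · rw [heq, integral_neg, neg_le_neg_iff]
    exact integral_mono_ae hcell hgi hlow

/-- If `φ` is Lipschitz on sets of measure arbitrarily close to one, then its graph measure has
information dimension one. -/
theorem hasInfoDim_graphMeasure (hφ : Measurable φ)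
    (hlip : ∀ δ : ℝ, 0 < δ → ∃ (E : Set UnitAddCircle) (K : ℝ),
      (∀ θ ∈ E, ∀ θ' ∈ E, |(φ θ : ℝ) - φ θ'| ≤ K * dist θ θ') ∧ volume.real Eᶜ ≤ δ) :
    HasInfoDim (graphMeasure φ) 1 := by
  have hN : ∀ ε : ℝ, ε ∈ Set.Ioo (0 : ℝ) 1 → ∃ N : ℕ, N ≠ 0 ∧ 1 / (N : ℝ) ≤ ε ∧
      (N : ℝ) ≤ 2 / ε := by
    intro ε hε
    have h0 : 0 < 1 / ε := one_div_pos.2 hε.1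
    have h1 : (0 : ℝ) < ⌈1 / ε⌉₊ := Nat.cast_pos.2 (Nat.ceil_pos.2 h0)
    refine ⟨⌈1 / ε⌉₊, (Nat.ceil_pos.2 h0).ne', ?_, ?_⟩
    · rw [one_div_le h1 hε.1]
      exact Nat.le_ceil _
    · have h2 := (Nat.ceil_lt_add_one h0.le).le
      have h3 : 1 ≤ 1 / ε := by
        rw [le_div_iff₀ hε.1]
        linarith [hε.2]
      have h4 : 2 / ε = 1 / ε + 1 / ε := by ring
      linarith
  have hsmall : ∀ᶠ ε : ℝ in 𝓝[>] 0, ε ∈ Set.Ioo (0 : ℝ) 1 := Ioo_mem_nhdsGT one_pos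
  have hlog : Tendsto (fun ε : ℝ => -Real.log ε) (𝓝[>] 0) atTop :=
    tendsto_neg_atBot_atTop.comp Real.tendsto_log_nhdsGT_zero
  have hratio : Tendsto (infoRatio (graphMeasure φ)) (𝓝[>] 0) (𝓝 1) := by
    refine tendsto_order.2 ⟨fun a ha => ?_, fun b hb => ?_⟩
    · have h1 : Tendsto (fun ε : ℝ => 1 - Real.log 2 / -Real.log ε) (𝓝[>] 0) (𝓝 (1 - 0)) :=
        (hlog.const_div_atTop _).const_sub 1
      rw [sub_zero] at h1
      filter_upwards [h1.eventually (lt_mem_nhds ha), hsmall] with ε h2 hε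
      obtain ⟨N, hN0, hN1, -⟩ := hN ε hε
      have : NeZero N := ⟨hN0⟩
      have h3 := (integral_neg_log_ball_bounds hφ hε.1 hN1).2.1
      have hL : 0 < -Real.log ε := neg_pos.2 (Real.log_neg hε.1 hε.2)
      rw [Real.log_mul two_ne_zero hε.1.ne'] at h3
      refine h2.trans_le ?_
      rw [infoRatio_eq_neg_div_neg, le_div_iff₀ hL, sub_mul, div_mul_cancel₀ _ hL.ne']
      linarith
    · obtain ⟨E, K, hE, hδ⟩ := hlip ((b - 1) / 4) (by linarith)
      set δ : ℝ := (b - 1) / 4 with hδdef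
      set K' := max K 0 with hK'
      have hK'0 : 0 ≤ K' := le_max_right _ _
      have hE' : ∀ θ ∈ E, ∀ θ' ∈ E, |(φ θ : ℝ) - φ θ'| ≤ K' * dist θ θ' :=
        fun θ hθ θ' hθ' => (hE θ hθ θ' hθ').trans
          (mul_le_mul_of_nonneg_right (le_max_left _ _) dist_nonneg)
      set A : ℝ := 1 + Real.log (K' + 2) + Real.log 2 + δ * (3 * Real.log 2) with hA
      have h1 : Tendsto (fun ε : ℝ => A / -Real.log ε + (1 + 2 * δ)) (𝓝[>] 0)
          (𝓝 (0 + (1 + 2 * δ))) := (hlog.const_div_atTop _).add_const _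
      have hb' : 0 + (1 + 2 * δ) < b := by
        rw [hδdef]
        linarith
      filter_upwards [h1.eventually (gt_mem_nhds hb'), hsmall] with ε h2 hε
      obtain ⟨N, hN0, hN1, hN2⟩ := hN ε hε
      have : NeZero N := ⟨hN0⟩
      have hNpos : (0 : ℝ) < N := Nat.cast_pos.2 (NeZero.pos N)
      have h3 := (integral_neg_log_ball_bounds hφ hε.1 hN1).2.2
      have h4 := entropy_gridCell_le hφ hK'0 hE' hδ N
      have hL : 0 < -Real.log ε := neg_pos.2 (Real.log_neg hε.1 hε.2)
      have h5 : Real.log N ≤ Real.log 2 + -Real.log ε := by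
        have := Real.log_le_log hNpos hN2
        rwa [Real.log_div two_ne_zero hε.1.ne', sub_eq_add_neg] at this
      have hδ0 : 0 ≤ δ := measureReal_nonneg.trans hδ
      rw [Real.log_mul (by positivity) hNpos.ne', Real.log_mul two_ne_zero (by positivity),
        Real.log_pow] at h4
      refine lt_of_le_of_lt ?_ h2
      rw [infoRatio_eq_neg_div_neg, div_le_iff₀ hL, add_mul, div_mul_cancel₀ _ hL.ne', hA]
      have h6 := mul_le_mul_of_nonneg_left h5 hδ0
      push_cast at h4
      linarith
  have hcoe := (continuous_coe_real_ereal.tendsto 1).comp hratio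
  refine ⟨?_, hcoe.liminf_eq, hcoe.limsup_eq⟩
  filter_upwards [hsmall] with ε hε
  obtain ⟨N, hN0, hN1, -⟩ := hN ε hε
  have : NeZero N := ⟨hN0⟩
  exact (integral_neg_log_ball_bounds hφ hε.1 hN1).1

end InfoDim

/-! ### The choice of the parameters -/

theorem IsDiophantine.addOrderOf_eq_zero {c d ρ : ℝ} (hc : 0 < c) (h : IsDiophantine c d ρ) :
    addOrderOf (ρ : UnitAddCircle) = 0 := by
  by_contra h0
  have h1 := h _ (Nat.one_le_iff_ne_zero.2 h0)
  have h2 : (((addOrderOf (ρ : UnitAddCircle) : ℕ) : ℝ) * ρ : ℝ) = (0 : UnitAddCircle) := by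
    rw [← nsmul_eq_mul, AddCircle.coe_nsmul, addOrderOf_nsmul_eq_zero]
  rw [h2, dist_self] at h1
  have h3 : (0 : ℝ) < (addOrderOf (ρ : UnitAddCircle) : ℕ) :=
    Nat.cast_pos.2 (Nat.pos_of_ne_zero h0)
  have h4 := mul_pos hc (Real.rpow_pos_of_pos h3 (-d))
  linarith

/-- The elementary largeness conditions on `κ`, with the threshold `κ ^ (-1 / 2)` between small
and large values. -/
theorem exists_forall_large (S : ℝ) : ∃ κ₀ : ℝ, ∀ κ : ℝ, κ₀ ≤ κ →
    1 < κ ∧ κ ≤ Real.cosh (Real.sqrt κ) ∧ S < 1 / 8 * Real.log (Real.sqrt κ) := by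
  have h1 : Tendsto (fun κ : ℝ => Real.log (Real.sqrt κ)) atTop atTop :=
    Real.tendsto_log_atTop.comp Real.tendsto_sqrt_atTop
  have h2 := h1.eventually (eventually_gt_atTop (8 * S))
  obtain ⟨κ₀, h⟩ := eventually_atTop.1 (h2.and (eventually_ge_atTop 144))
  refine ⟨κ₀, fun κ hκ => ?_⟩
  obtain ⟨h3, h4⟩ := h κ hκ
  refine ⟨by linarith, ?_, by linarith⟩
  have h5 : (12 : ℝ) ≤ Real.sqrt κ := Real.le_sqrt_of_sq_le (by linarith)
  have h6 : Real.sqrt κ ^ 2 = κ := Real.sq_sqrt (by linarith)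
  have h7 := Real.pow_div_factorial_le_exp (Real.sqrt κ) (Real.sqrt_nonneg κ) 3
  have h8 : ((Nat.factorial 3 : ℕ) : ℝ) = 6 := by norm_num [Nat.factorial]
  rw [h8] at h7
  have h9 := Real.exp_pos (-Real.sqrt κ)
  rw [Real.cosh_eq]
  have h10 : 12 * κ ≤ Real.sqrt κ ^ 3 := by
    rw [pow_succ', h6]
    exact mul_le_mul_of_nonneg_right h5 (by linarith)
  linarith

end PinchedSkew

theorem corollary3 (c d : ℝ) (hc : 0 < c) (hd : 1 < d) :
    ∃ κ₀ : ℝ, ∀ ρ : ℝ, PinchedSkew.IsDiophantine c d ρ →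
      ∀ (κ : ℝ) (hκ : 0 < κ), κ₀ ≤ κ →
        PinchedSkew.HasInfoDim
          (PinchedSkew.graphMeasure (PinchedSkew.upperGraph ρ κ hκ)) 1 := by
  obtain ⟨κ₀, hκ₀⟩ := PinchedSkew.exists_forall_large
    (Real.log 2 - ∫ θ, Real.log (PinchedSkew.forcing θ))
  refine ⟨κ₀, fun ρ hρ κ hκ hle => ?_⟩
  obtain ⟨hκ1, hcosh, hS⟩ := hκ₀ κ hle
  refine PinchedSkew.hasInfoDim_graphMeasure (PinchedSkew.measurable_upperGraph hκ)
    fun δ hδ => ?_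
  set x : ℝ := (Real.sqrt κ)⁻¹ with hx
  have hsqrt : 0 < Real.sqrt κ := Real.sqrt_pos.2 hκ
  have hx0 : 0 ≤ x := (inv_pos.2 hsqrt).le
  have hκx : κ * x = Real.sqrt κ := by
    rw [hx, ← div_eq_mul_inv, Real.div_sqrt]
  have herg : Ergodic (fun θ : UnitAddCircle => θ + -(ρ : UnitAddCircle)) volume := by
    rw [AddCircle.ergodic_add_right, addOrderOf_neg]
    exact hρ.addOrderOf_eq_zero hc
  have hlow : volume.real (PinchedSkew.lowSet ρ κ hκ x) < 1 / 8 := by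
    have h2 := PinchedSkew.measureReal_upperGraph_lt_mul_le (ρ := ρ) hκ hκ1.le (x := x)
      (by rw [hκx]; exact Real.one_le_sqrt.2 hκ1.le)
    have h3 : -Real.log x = Real.log (Real.sqrt κ) := by rw [hx, Real.log_inv, neg_neg]
    have h4 : 0 < Real.log (Real.sqrt κ) := Real.log_pos (Real.lt_sqrt_of_sq_lt (by linarith))
    rw [h3, ← PinchedSkew.measureReal_lowSet] at h2
    exact lt_of_mul_lt_mul_right (h2.trans_lt hS) h4.le
  obtain ⟨C, hC⟩ := PinchedSkew.exists_measure_visits_gt_le herg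
    (PinchedSkew.measurableSet_lowSet hκ x) hlow hδ
  obtain ⟨K, hK⟩ := PinchedSkew.exists_lipschitz_upperGraph (ρ := ρ) hκ hκ1 hx0
    (by rwa [hκx]) C
  exact ⟨_, K, hK, hC⟩
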